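/- Let $D\ge 3$ and $N\ge 2$ be integers, and let $\Gamma=H(D,N)$ be the Hamming graph: its vertex set $X$ consists of the $D$-tuples of elements of $\{1,\dots,N\}$, and two vertices are adjacent when they differ in exactly one coordinate. Let $\partial$ be the path-length distance of $\Gamma$ (its diameter is $D$). Let $V=\mathbb R^X$ be the Euclidean space with orthonormal basis $\{\hat x\mid x\in X\}$ of characteristic vectors, and let $u\circ v$ denote the entrywise product of $u,v\in V$. Let $E=E_1$ be the primitive idempotent of $\Gamma$ for the eigenvalue $\theta_1=D(N-1)-N$ in the $Q$-polynomial (Krawtchouk type) ordering $\theta_i=D(N-1)-iN$ $(0\le i\le D)$ of the eigenvalues of the adjacency matrix; that is, $E$ is the orthogonal projection of $V$ onto the $\theta_1$-eigenspace of the adjacency matrix. For $x,y\in X$ with $i=\partial(x,y)$ put $$x^-_y=\sum_{\substack{z\in X\\ \partial(x,z)=1,\ \partial(y,z)=i-1}}\hat z,\qquad x^+_y=\sum_{\substack{z\in X\\ \partial(x,z)=1,\ \partial(y,z)=i+1}}\hat z .$$ Then the following hold. 1. For all $x,y\in X$ with $2\le i=\partial(x,y)\le D$, $$E x^-_y=(i-1)E\hat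 x+E\hat y .$$ 2. If $N=2$, then for all $x,y\in X$ with $1\le i=\partial(x,y)\le D-1$, $$E x^+_y=(D-i-1)E\hat x-E\hat y .$$ 3. For all $N\ge 2$, the set $\{E\hat x\mid x\in X\}$ is Norton-balanced: for all $x,y\in X$ and all $0\le i,j\le D$, $$\sum_{\substack{z\in X\\ \partial(x,z)=i,\ \partial(y,z)=j}}E\hat z\ \in\ \operatorname{Span}\{E\hat x,\ E\hat y,\ E\hat x\star E\hat y\},\qquad\text{where } u\star v=E(u\circ v).$$ -/

import Mathlib

namespace NortonBalanced

section General

variable {X : Type*} [Fintype X] [DecidableEq X]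

/-- The characteristic vector of the vertex `x` in the Euclidean space `V = ℝ^X`. -/
noncomputable def hat (x : X) : EuclideanSpace ℝ X := EuclideanSpace.single x (1 : ℝ)

/-- The entrywise product of two vectors of `V`. -/
noncomputable def entrywise (u v : EuclideanSpace ℝ X) : EuclideanSpace ℝ X :=
  WithLp.toLp 2 (fun z => u z * v z)

/-- The set of vertices at path-length distance `i` from `x`. -/
noncomputable def sphere (G : SimpleGraph X) (i : ℕ) (x : X) : Finset X :=
  {z | G.dist x z = i}

/-- The eigenspace in `V` of the adjacency matrix of `G` for the scalar `θ`. -/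
noncomputable def adjEigenspace (G : SimpleGraph X) [DecidableRel G.Adj] (θ : ℝ) :
    Submodule ℝ (EuclideanSpace ℝ X) :=
  Module.End.eigenspace (Matrix.toEuclideanLin (G.adjMatrix ℝ)) θ

/-- The primitive idempotent of `G` for the eigenvalue `θ` of the adjacency matrix: the orthogonal
projection of `V` onto the corresponding eigenspace (as an operator on `V`). -/
noncomputable def primitiveIdempotent (G : SimpleGraph X) [DecidableRel G.Adj] (θ : ℝ) :
    EuclideanSpace ℝ X →L[ℝ] EuclideanSpace ℝ X :=
  (adjEigenspace G θ).starProjection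

/-- `x⁻_y`: the sum of the vectors `ẑ` over the neighbours `z` of `x` at distance `∂(x,y) - 1`
from `y` (the empty sum, hence zero, if `x = y`). -/
noncomputable def vecMinus (G : SimpleGraph X) (x y : X) : EuclideanSpace ℝ X :=
  ∑ z with G.dist x z = 1 ∧ G.dist y z + 1 = G.dist x y, hat z

/-- `x⁺_y`: the sum of the vectors `ẑ` over the neighbours `z` of `x` at distance `∂(x,y) + 1`
from `y`. -/
noncomputable def vecPlus (G : SimpleGraph X) (x y : X) : EuclideanSpace ℝ X :=
  ∑ z with G.dist x z = 1 ∧ G.dist y z = G.dist x y + 1, hat z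

/-- The Norton product `u ⋆ v = E (u ∘ v)`, to be used for `u, v` in the range of `E`. -/
noncomputable def nortonProduct (E : EuclideanSpace ℝ X →L[ℝ] EuclideanSpace ℝ X)
    (u v : EuclideanSpace ℝ X) : EuclideanSpace ℝ X :=
  E (entrywise u v)

/-- The set of vectors `{E x̂ | x ∈ X}` is Norton-balanced: for all vertices `x, y` and all
`0 ≤ i, j ≤ diam G`, the sum of `E ẑ` over the vertices `z` at distance `i` from `x` and `j` from
`y` lies in the span of `E x̂`, `E ŷ`, `E x̂ ⋆ E ŷ`. -/
def IsNortonBalanced (G : SimpleGraph X)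
    (E : EuclideanSpace ℝ X →L[ℝ] EuclideanSpace ℝ X) : Prop :=
  ∀ x y : X, ∀ i j : ℕ, i ≤ G.diam → j ≤ G.diam →
    (∑ z ∈ sphere G i x ∩ sphere G j y, E (hat z)) ∈
      Submodule.span ℝ
        ({E (hat x), E (hat y), nortonProduct E (E (hat x)) (E (hat y))} :
          Set (EuclideanSpace ℝ X))

end General

/-- The Hamming graph `H(D,N)`: vertices are the `D`-tuples over an alphabet with `N` letters, two
being adjacent when they differ in exactly one coordinate. -/
def hammingGraph (D N : ℕ) : SimpleGraph (Fin D → Fin N) where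
  Adj x y := ∃! j : Fin D, x j ≠ y j
  symm := ⟨fun _ _ ⟨j, hj, h⟩ => ⟨j, Ne.symm hj, fun k hk => h k (Ne.symm hk)⟩⟩
  loopless := ⟨fun _ ⟨_, hj, _⟩ => hj rfl⟩

noncomputable instance (D N : ℕ) : DecidableRel (hammingGraph D N).Adj := Classical.decRel _

/-- The eigenvalue `θ_i = D(N-1) - iN` of `H(D,N)`, in the order of the `Q`-polynomial structure of
Krawtchouk type. -/
def hammingEigenvalue (D N i : ℕ) : ℝ := (D : ℝ) * ((N : ℝ) - 1) - (i : ℝ) * (N : ℝ)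

/-- The primitive idempotent `E_i` of `H(D,N)` associated with the eigenvalue `θ_i`. -/
noncomputable def hammingIdempotent (D N i : ℕ) :
    EuclideanSpace ℝ (Fin D → Fin N) →L[ℝ] EuclideanSpace ℝ (Fin D → Fin N) :=
  primitiveIdempotent (hammingGraph D N) (hammingEigenvalue D N i)

end NortonBalanced

/-! Factoring `hat x` over the coordinates as a product of `(δ - 1/N) + 1/N` and expanding gives one
eigenvector `character S x` per set `S` of coordinates, with eigenvalue `θ_{|S|}`. Applying `E`
keeps only the singletons, so `E x̂` is a scalar times `∑ j, coordVec j (x j)`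
(`hammingIdempotent_hat`). Parts 1 and 2 are then bookkeeping of single-coordinate changes.

For part 3, the Norton product supplies the sum of `coordVec j (x j)` over the coordinates where `x`
and `y` agree (`nortonProduct_hammingIdempotent_hat`). The span therefore contains this sum and the
sums for `x` and for `y` over the other coordinates. Since the number of `z` in the sphere
intersection with `z k = a` depends only on which of `x k`, `y k`, `a` are equal
(`exists_card_sphere_inter_eq`), the required sum is a combination of these three vectors. -/

namespace NortonBalanced

open Finset

/-! ### Path distance is Hamming distance; sums over neighbours. -/

section Distance

variable {D N : ℕ}

theorem hammingDist_eq_sum (x y : Fin D → Fin N) :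
    hammingDist x y = ∑ l, if x l = y l then 0 else 1 := by
  simp only [hammingDist, Finset.card_filter, ne_eq, ite_not]

/-- The indicators sit on opposite sides to avoid subtraction in `ℕ`. -/
theorem hammingDist_update_add (x y : Fin D → Fin N) (j : Fin D) (b : Fin N) :
    hammingDist y (Function.update x j b) + (if y j = x j then 0 else 1) =
      hammingDist y x + (if y j = b then 0 else 1) := by
  rw [hammingDist_eq_sum, hammingDist_eq_sum, ← Finset.add_sum_erase _ _ (mem_univ j),
    ← Finset.add_sum_erase (f := fun l => if y l = x l then 0 else 1) _ (mem_univ j)]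
  have h : ∑ l ∈ univ.erase j, (if y l = Function.update x j b l then 0 else 1) =
      ∑ l ∈ univ.erase j, if y l = x l then 0 else 1 := by
    refine Finset.sum_congr rfl fun l hl => ?_
    rw [Function.update_of_ne (Finset.ne_of_mem_erase hl)]
  rw [h, Function.update_self]
  ring

theorem hammingGraph_adj_iff (x z : Fin D → Fin N) :
    (hammingGraph D N).Adj x z ↔ ∃ j, ∃ b, b ≠ x j ∧ Function.update x j b = z := by
  constructor
  · rintro ⟨j, hj, h⟩
    refine ⟨j, z j, Ne.symm hj, funext fun l => ?_⟩
    rcases eq_or_ne l j with rfl | hl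
    · simp
    · rw [Function.update_of_ne hl]
      by_contra hne
      exact hl (h l hne)
  · rintro ⟨j, b, hb, rfl⟩
    refine ⟨j, by simpa using Ne.symm hb, fun l hl => ?_⟩
    by_contra hne
    exact hl (by simp [Function.update_of_ne hne])

theorem hammingDist_of_adj {x z : Fin D → Fin N} (h : (hammingGraph D N).Adj x z) :
    hammingDist x z = 1 := by
  obtain ⟨j, b, hb, rfl⟩ := (hammingGraph_adj_iff x z).1 h
  have := hammingDist_update_add x x j b
  simpa [Ne.symm hb] using this

theorem hammingDist_le_length {x y : Fin D → Fin N} (p : (hammingGraph D N).Walk x y) :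
    hammingDist x y ≤ p.length := by
  induction p with
  | nil => simp
  | @cons u v w h p ih =>
    have h1 := hammingDist_triangle u v w
    rw [hammingDist_of_adj h] at h1
    rw [SimpleGraph.Walk.length_cons]
    omega

theorem exists_walk_length_eq_hammingDist (n : ℕ) :
    ∀ x y : Fin D → Fin N, hammingDist x y = n →
      ∃ p : (hammingGraph D N).Walk x y, p.length = n := by
  induction n with
  | zero =>
    intro x y h
    obtain rfl := hammingDist_eq_zero.1 h
    exact ⟨.nil, rfl⟩
  | succ n ih =>
    intro x y h
    have hne : x ≠ y := fun e => by simp [e] at h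
    obtain ⟨j, hj⟩ := Function.ne_iff.1 hne
    have h1 := hammingDist_update_add x y j (y j)
    rw [if_neg (Ne.symm hj), if_pos rfl, hammingDist_comm y x, h, hammingDist_comm] at h1
    obtain ⟨p, hp⟩ := ih (Function.update x j (y j)) y (by omega)
    have hadj := (hammingGraph_adj_iff x _).2 ⟨j, y j, Ne.symm hj, rfl⟩
    exact ⟨.cons hadj p, by simp [hp]⟩

theorem hammingGraph_dist (x y : Fin D → Fin N) :
    (hammingGraph D N).dist x y = hammingDist x y := by
  obtain ⟨p, hp⟩ := exists_walk_length_eq_hammingDist _ x y rfl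
  refine le_antisymm (hp ▸ SimpleGraph.dist_le p) ?_
  obtain ⟨q, hq⟩ := p.reachable.exists_walk_length_eq_dist
  exact hq ▸ hammingDist_le_length q

theorem hammingGraph_sum_neighbor {M : Type*} [AddCommMonoid M] (x : Fin D → Fin N)
    (f : (Fin D → Fin N) → M) :
    ∑ z with (hammingGraph D N).Adj x z, f z =
      ∑ j, ∑ b with b ≠ x j, f (Function.update x j b) := by
  rw [Finset.sum_sigma']
  symm
  refine Finset.sum_nbij (fun p => Function.update x p.1 p.2) ?_ ?_ ?_ fun _ _ => rfl
  · rintro ⟨j, b⟩ h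
    simp only [mem_sigma, mem_univ, mem_filter, true_and] at h ⊢
    exact (hammingGraph_adj_iff x _).2 ⟨j, b, h, rfl⟩
  · rintro ⟨j, b⟩ h ⟨k, c⟩ h' e
    simp only [coe_sigma, Set.mem_sigma_iff, coe_filter, Set.mem_ofPred_eq, mem_univ,
      true_and, coe_univ, Set.mem_univ] at h h'
    have e : Function.update x j b = Function.update x k c := e
    have hjk : j = k := by
      by_contra hne
      have := congrFun e j
      rw [Function.update_self, Function.update_of_ne hne] at this
      exact h this
    subst hjk
    have := congrFun e j
    simp only [Function.update_self] at this
    rw [this]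
  · intro z hz
    simp only [coe_filter, mem_univ, true_and, Set.mem_ofPred_eq] at hz
    obtain ⟨j, b, hb, rfl⟩ := (hammingGraph_adj_iff x z).1 hz
    exact ⟨⟨j, b⟩, by simpa using hb, rfl⟩

end Distance

/-! ### Product eigenvectors and the formula for `E x̂`. -/

section Eigenvectors

variable {D N : ℕ}

/-- The function `w ↦ ∏_{j ∈ S} (δ(w_j, a_j) - 1/N)`, an eigenvector of `H(D,N)` for `θ_{|S|}`. -/
noncomputable def character (S : Finset (Fin D)) (a : Fin D → Fin N) :
    EuclideanSpace ℝ (Fin D → Fin N) :=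
  WithLp.toLp 2 fun w => ∏ j ∈ S, ((if w j = a j then 1 else 0) - (N : ℝ)⁻¹)

/-- The function `w ↦ δ(w_j, a) - 1/N`. -/
noncomputable def coordVec (j : Fin D) (a : Fin N) : EuclideanSpace ℝ (Fin D → Fin N) :=
  WithLp.toLp 2 fun w => (if w j = a then 1 else 0) - (N : ℝ)⁻¹

theorem sum_coordVec_coeff [NeZero N] (a : Fin N) :
    ∑ b : Fin N, ((if b = a then 1 else 0) - (N : ℝ)⁻¹) = 0 := by
  have : (N : ℝ) ≠ 0 := NeZero.ne _
  simp [this]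

theorem sum_coordVec [NeZero N] (j : Fin D) : ∑ a : Fin N, coordVec j a = 0 := by
  have : (N : ℝ) ≠ 0 := NeZero.ne _
  ext w
  simp [coordVec, this]

theorem character_singleton (j : Fin D) (a : Fin D → Fin N) :
    character {j} a = coordVec j (a j) := by
  simp [character, coordVec]

theorem character_sum_update [NeZero N] (S : Finset (Fin D)) (a w : Fin D → Fin N) (j : Fin D) :
    ∑ b, character S a (Function.update w j b) =
      if j ∈ S then 0 else (N : ℝ) * character S a w := by
  simp only [character]
  split_ifs with hj
  · have h : ∀ b, ∏ l ∈ S, ((if Function.update w j b l = a l then 1 else 0) - (N : ℝ)⁻¹) =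
        ((if b = a j then 1 else 0) - (N : ℝ)⁻¹) *
          ∏ l ∈ S.erase j, ((if w l = a l then 1 else 0) - (N : ℝ)⁻¹) := by
      intro b
      rw [← Finset.mul_prod_erase _ _ hj, Function.update_self]
      congr 1
      refine Finset.prod_congr rfl fun l hl => ?_
      rw [Function.update_of_ne (Finset.ne_of_mem_erase hl)]
    simp only [h]
    rw [← Finset.sum_mul, sum_coordVec_coeff, zero_mul]
  · have h : ∀ b, ∏ l ∈ S, ((if Function.update w j b l = a l then 1 else 0) - (N : ℝ)⁻¹) =
          ∏ l ∈ S, ((if w l = a l then 1 else 0) - (N : ℝ)⁻¹) := by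
      intro b
      refine Finset.prod_congr rfl fun l hl => ?_
      rw [Function.update_of_ne (ne_of_mem_of_not_mem hl hj)]
    simp only [h]
    simp

/-- The neighbours in direction `j` contribute the sum over the whole line minus the value at `w`: a
factor `-1` if `j ∈ S` and `N - 1` otherwise. In total this is `(D - |S|)(N - 1) - |S| = θ_{|S|}`.
-/
theorem character_mem_adjEigenspace [NeZero N] (S : Finset (Fin D)) (a : Fin D → Fin N) :
    character S a ∈ adjEigenspace (hammingGraph D N) (hammingEigenvalue D N #S) := by
  rw [adjEigenspace, Module.End.mem_eigenspace_iff]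
  ext w
  have h1 : (Matrix.toEuclideanLin ((hammingGraph D N).adjMatrix ℝ) (character S a)) w =
      ∑ z with (hammingGraph D N).Adj w z, character S a z := by
    simp [Matrix.toLpLin_apply, Matrix.mulVec, dotProduct, SimpleGraph.adjMatrix_apply,
      Finset.sum_filter]
  rw [h1, hammingGraph_sum_neighbor]
  have h2 : ∀ j, ∑ b with b ≠ w j, character S a (Function.update w j b) =
      (if j ∈ S then 0 else (N : ℝ) * character S a w) - character S a w := by
    intro j
    rw [← character_sum_update, ← Finset.sum_filter_add_sum_filter_not univ (fun b => b ≠ w j)]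
    simp [Finset.filter_eq']
  simp only [h2]
  rw [Finset.sum_sub_distrib, Finset.sum_ite]
  have h3 : (#{j : Fin D | j ∉ S} : ℝ) = D - #S := by
    have := Finset.card_compl S
    rw [Fintype.card_fin] at this
    have hle : #S ≤ D := by simpa using Finset.card_le_univ S
    rw [← Nat.cast_sub hle, ← this]
    congr 2
    ext
    simp
  simp only [sum_const_zero, zero_add, sum_const, nsmul_eq_mul, h3, PiLp.smul_apply, smul_eq_mul,
    card_univ, Fintype.card_fin, hammingEigenvalue]
  ring

theorem primitiveIdempotent_of_mem {X : Type*} [Fintype X] [DecidableEq X] (G : SimpleGraph X)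
    [DecidableRel G.Adj] {θ : ℝ} {u : EuclideanSpace ℝ X} (hu : u ∈ adjEigenspace G θ) :
    primitiveIdempotent G θ u = u :=
  Submodule.starProjection_eq_self_iff.2 hu

theorem primitiveIdempotent_of_mem_of_ne {X : Type*} [Fintype X] [DecidableEq X]
    (G : SimpleGraph X) [DecidableRel G.Adj] {θ η : ℝ} (h : η ≠ θ) {u : EuclideanSpace ℝ X}
    (hu : u ∈ adjEigenspace G η) : primitiveIdempotent G θ u = 0 := by
  have hsymm : (Matrix.toEuclideanLin (G.adjMatrix ℝ)).IsSymmetric := by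
    refine Matrix.isSymmetric_toEuclideanLin_iff.2 ?_
    ext x y
    simp [SimpleGraph.adjMatrix_apply, SimpleGraph.adj_comm]
  have hort := hsymm.orthogonalFamily_eigenspaces
  refine (Submodule.starProjection_apply_eq_zero_iff _).2 ?_
  rw [Submodule.mem_orthogonal]
  intro v hv
  exact hort h.symm ⟨v, hv⟩ ⟨u, hu⟩

theorem hammingIdempotent_character [NeZero N] (S : Finset (Fin D)) (a : Fin D → Fin N) :
    hammingIdempotent D N 1 (character S a) = if #S = 1 then character S a else 0 := by
  have hm := character_mem_adjEigenspace S a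
  split_ifs with h
  · rw [h] at hm
    exact primitiveIdempotent_of_mem _ hm
  · refine primitiveIdempotent_of_mem_of_ne _ (fun e => h ?_) hm
    have hN : (N : ℝ) ≠ 0 := NeZero.ne _
    simp only [hammingEigenvalue] at e
    have : ((#S : ℕ) : ℝ) * N = ((1 : ℕ) : ℝ) * N := by linarith
    exact_mod_cast mul_right_cancel₀ hN this

theorem hat_eq_sum_character (x : Fin D → Fin N) :
    hat x = ∑ S : Finset (Fin D), ((N : ℝ)⁻¹ ^ (D - #S)) • character S x := by
  ext w
  have h : (hat x) w = ∏ j, (((if w j = x j then 1 else 0) - (N : ℝ)⁻¹) + (N : ℝ)⁻¹) := by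
    simp only [sub_add_cancel, hat, PiLp.single_apply, Finset.prod_ite_zero, mem_univ, true_imp_iff,
      prod_const_one]
    exact if_congr funext_iff rfl rfl
  rw [h, Finset.prod_add]
  simp only [WithLp.ofLp_sum, Finset.sum_apply, PiLp.smul_apply, smul_eq_mul, character, prod_const,
    powerset_univ]
  refine Finset.sum_congr rfl fun S _ => ?_
  rw [Finset.card_sdiff_of_subset (subset_univ S), mul_comm]
  simp

theorem hammingIdempotent_hat [NeZero N] (x : Fin D → Fin N) :
    hammingIdempotent D N 1 (hat x) = ((N : ℝ)⁻¹ ^ (D - 1)) • ∑ j, coordVec j (x j) := by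
  rw [hat_eq_sum_character, map_sum, Finset.smul_sum]
  simp only [map_smul, hammingIdempotent_character, smul_ite, smul_zero]
  rw [← Finset.sum_filter]
  symm
  refine Finset.sum_nbij (fun j => {j}) ?_ ?_ ?_ ?_
  · simp
  · intro i _ j _ h
    simpa using h
  · intro S hS
    obtain ⟨j, rfl⟩ := Finset.card_eq_one.1 (by simpa using hS)
    exact ⟨j, by simp, rfl⟩
  · intro j _
    rw [card_singleton, character_singleton]

theorem hammingIdempotent_coordVec [NeZero N] (j : Fin D) (a : Fin N) :
    hammingIdempotent D N 1 (coordVec j a) = coordVec j a := by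
  have := hammingIdempotent_character {j} (fun _ : Fin D => a)
  simpa [character_singleton] using this

theorem hammingIdempotent_hat_update [NeZero N] (x : Fin D → Fin N) (j : Fin D) (b : Fin N) :
    hammingIdempotent D N 1 (hat (Function.update x j b)) = hammingIdempotent D N 1 (hat x) +
      ((N : ℝ)⁻¹ ^ (D - 1)) • (coordVec j b - coordVec j (x j)) := by
  rw [hammingIdempotent_hat, hammingIdempotent_hat, ← smul_add]
  congr 1
  rw [← Finset.add_sum_erase _ _ (mem_univ j),
    ← Finset.add_sum_erase (f := fun l => coordVec l (x l)) _ (mem_univ j)]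
  have h : ∑ l ∈ univ.erase j, coordVec l (Function.update x j b l) =
      ∑ l ∈ univ.erase j, coordVec l (x l) := by
    refine Finset.sum_congr rfl fun l hl => ?_
    rw [Function.update_of_ne (Finset.ne_of_mem_erase hl)]
  rw [h, Function.update_self]
  abel

end Eigenvectors

/-! ### Parts 1 and 2: the vectors `x⁻_y` and `x⁺_y`. -/

section NeighborSums

variable {D N : ℕ}

theorem vecMinus_eq_sum (x y : Fin D → Fin N) :
    vecMinus (hammingGraph D N) x y = ∑ j with x j ≠ y j, hat (Function.update x j (y j)) := by
  simp only [vecMinus, SimpleGraph.dist_eq_one_iff_adj]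
  simp only [hammingGraph_dist]
  rw [← Finset.filter_filter, Finset.sum_filter, hammingGraph_sum_neighbor, Finset.sum_filter]
  refine Finset.sum_congr rfl fun j _ => ?_
  have h : ∀ b ∈ ({b | b ≠ x j} : Finset (Fin N)),
      (hammingDist y (Function.update x j b) + 1 = hammingDist x y ↔ y j = b) := by
    intro b hb
    simp only [mem_filter, mem_univ, true_and] at hb
    have := hammingDist_update_add x y j b
    rw [hammingDist_comm x y]
    by_cases h2 : y j = b
    · rw [if_pos h2, if_neg (fun h1 => hb (h2.symm.trans h1))] at this
      exact iff_of_true this h2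
    · rw [if_neg h2] at this
      refine iff_of_false (fun h => ?_) h2
      split_ifs at this <;> omega
  rw [Finset.sum_congr rfl fun b hb => if_congr (h b hb) rfl rfl, Finset.sum_ite_eq]
  simp [eq_comm]

theorem vecPlus_eq_sum (x y : Fin D → Fin N) :
    vecPlus (hammingGraph D N) x y =
      ∑ j with x j = y j, ∑ b with b ≠ x j, hat (Function.update x j b) := by
  simp only [vecPlus, SimpleGraph.dist_eq_one_iff_adj]
  simp only [hammingGraph_dist]
  rw [← Finset.filter_filter, Finset.sum_filter, hammingGraph_sum_neighbor, Finset.sum_filter]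
  refine Finset.sum_congr rfl fun j _ => ?_
  have h : ∀ b ∈ ({b | b ≠ x j} : Finset (Fin N)),
      (hammingDist y (Function.update x j b) = hammingDist x y + 1 ↔ x j = y j) := by
    intro b hb
    simp only [mem_filter, mem_univ, true_and] at hb
    have := hammingDist_update_add x y j b
    rw [hammingDist_comm x y]
    rw [eq_comm (a := x j)]
    by_cases h1 : y j = x j
    · rw [if_pos h1, if_neg (fun h2 => hb (h2.symm.trans h1))] at this
      exact iff_of_true this h1
    · rw [if_neg h1] at this
      refine iff_of_false (fun h => ?_) h1
      split_ifs at this <;> omega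
  rw [Finset.sum_congr rfl fun b hb => if_congr (h b hb) rfl rfl]
  split_ifs <;> simp

theorem card_ne_eq_hammingDist (x y : Fin D → Fin N) : #{j | x j ≠ y j} = hammingDist x y := rfl

theorem card_eq_add_hammingDist (x y : Fin D → Fin N) :
    #{j | x j = y j} + hammingDist x y = D := by
  rw [← card_ne_eq_hammingDist, Finset.card_filter_add_card_filter_not, card_univ,
    Fintype.card_fin]

/-- Each of the `∂(x,y)` neighbours contributes `E x̂` plus the correction at one differing
coordinate; these corrections add up to `E ŷ - E x̂`. -/
theorem hammingIdempotent_vecMinus [NeZero N] (x y : Fin D → Fin N) :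
    hammingIdempotent D N 1 (vecMinus (hammingGraph D N) x y) =
      ((hammingDist x y : ℝ) - 1) • hammingIdempotent D N 1 (hat x) +
        hammingIdempotent D N 1 (hat y) := by
  have h : ∑ j with x j ≠ y j, (coordVec j (y j) - coordVec j (x j)) =
      ∑ j, coordVec j (y j) - ∑ j, coordVec j (x j) := by
    rw [← Finset.sum_sub_distrib, Finset.sum_filter]
    refine Finset.sum_congr rfl fun j _ => ?_
    split_ifs with h
    · rfl
    · rw [not_not.1 h, sub_self]
  rw [vecMinus_eq_sum, map_sum]
  simp only [hammingIdempotent_hat_update]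
  rw [Finset.sum_add_distrib, ← Finset.smul_sum, h, Finset.sum_const, card_ne_eq_hammingDist,
    smul_sub, ← hammingIdempotent_hat, ← hammingIdempotent_hat]
  module

theorem coordVec_of_ne {j : Fin D} {a b : Fin 2} (h : b ≠ a) :
    coordVec j b = -coordVec j a := by
  have h1 := sum_coordVec (N := 2) j
  rw [Fin.sum_univ_two] at h1
  fin_cases a <;> fin_cases b <;> simp_all [eq_neg_iff_add_eq_zero, add_comm]

theorem hammingIdempotent_vecPlus_two (x y : Fin D → Fin 2) :
    hammingIdempotent D 2 1 (vecPlus (hammingGraph D 2) x y) =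
      ((D : ℝ) - hammingDist x y - 1) • hammingIdempotent D 2 1 (hat x) -
        hammingIdempotent D 2 1 (hat y) := by
  have hcard : (#{j | x j = y j} : ℝ) = D - hammingDist x y := by
    rw [eq_sub_iff_add_eq]
    exact_mod_cast card_eq_add_hammingDist x y
  have h1 : ∀ j, ∑ b with b ≠ x j, hammingIdempotent D 2 1 (hat (Function.update x j b)) =
      hammingIdempotent D 2 1 (hat x) +
        (((2 : ℕ) : ℝ)⁻¹ ^ (D - 1)) • ((-2 : ℝ) • coordVec j (x j)) := by
    intro j
    have hc : #{b : Fin 2 | b ≠ x j} = 1 := by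
      generalize x j = c
      revert c
      decide
    rw [Finset.sum_congr rfl (g := fun _ => hammingIdempotent D 2 1 (hat x) +
        (((2 : ℕ) : ℝ)⁻¹ ^ (D - 1)) • ((-2 : ℝ) • coordVec j (x j))), Finset.sum_const, hc,
        one_smul]
    intro b hb
    rw [hammingIdempotent_hat_update, coordVec_of_ne (by simpa using hb)]
    module
  -- Where `x` and `y` differ, their two coordinate vectors are opposite and cancel on the right.
  have h : ∑ j with x j = y j, (-2 : ℝ) • coordVec j (x j) =
      -(∑ j, coordVec j (y j) + ∑ j, coordVec j (x j)) := by
    rw [← Finset.sum_add_distrib, Finset.sum_filter, ← Finset.sum_neg_distrib]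
    refine Finset.sum_congr rfl fun j _ => ?_
    split_ifs with h
    · rw [h]
      module
    · rw [coordVec_of_ne h]
      simp
  rw [vecPlus_eq_sum, map_sum]
  simp only [map_sum, h1]
  rw [Finset.sum_add_distrib, ← Finset.smul_sum, h, Finset.sum_const, smul_neg,
    smul_add, ← hammingIdempotent_hat, ← hammingIdempotent_hat, ← Nat.cast_smul_eq_nsmul ℝ, hcard]
  module

end NeighborSums

/-! ### Sphere intersections counted by a bivariate generating function. -/

section IntersectionCounts

open Polynomial

variable {D N : ℕ}

/-- The monomial in `ℝ[X][Y]` recording whether the letter `b` differs from `p` and from `q`. -/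
noncomputable def letterWeight (p q b : Fin N) : ℝ[X][X] :=
  (C X) ^ (if p = b then 0 else 1) * X ^ (if q = b then 0 else 1)

theorem prod_letterWeight (x y z : Fin D → Fin N) :
    ∏ l, letterWeight (x l) (y l) (z l) = (C X) ^ hammingDist x z * X ^ hammingDist y z := by
  simp only [letterWeight, Finset.prod_mul_distrib, Finset.prod_pow_eq_pow_sum, hammingDist_eq_sum]

theorem sum_letterWeight (p q : Fin N) :
    ∑ b, letterWeight p q b = if p = q then (N : ℝ[X][X]) * (C X * X) + (1 - C X * X)
      else (N : ℝ[X][X]) * (C X * X) + (X - C X * X) + (C X - C X * X) := by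
  split_ifs with h
  · subst h
    have : ∀ b, letterWeight p p b = C X * X + if p = b then 1 - C X * X else 0 := by
      intro b
      simp only [letterWeight]
      split_ifs <;> simp
    simp only [this, Finset.sum_add_distrib, Finset.sum_ite_eq]
    simp
  · have : ∀ b, letterWeight p q b = C X * X + (if p = b then X - C X * X else 0) +
        (if q = b then C X - C X * X else 0) := by
      intro b
      simp only [letterWeight]
      split_ifs with h1 h2 <;> simp_all
    simp only [this, Finset.sum_add_distrib, Finset.sum_ite_eq]
    simp

theorem sum_prod_letterWeight (x y : Fin D → Fin N) (k : Fin D) (a : Fin N) :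
    ∑ z : Fin D → Fin N with z k = a, ∏ l, letterWeight (x l) (y l) (z l) =
      letterWeight (x k) (y k) a *
        ∏ l ∈ univ.erase k, ∑ b, letterWeight (x l) (y l) b := by
  -- The constraint `z k = a` is moved into the `k`-th factor, so that the sum over `z` factors by
  -- coordinates.
  have h : ∀ z : Fin D → Fin N, (if z k = a then ∏ l, letterWeight (x l) (y l) (z l) else 0) =
      ∏ l, if l = k ∧ z l ≠ a then 0 else letterWeight (x l) (y l) (z l) := by
    intro z
    split_ifs with hz
    · refine Finset.prod_congr rfl fun l _ => ?_
      rw [if_neg]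
      rintro ⟨rfl, h⟩
      exact h hz
    · exact (Finset.prod_eq_zero (mem_univ k) (by simp [hz])).symm
  rw [Finset.sum_filter, Finset.sum_congr rfl fun z _ => h z,
    ← Fintype.prod_sum (fun l b => if l = k ∧ b ≠ a then 0 else letterWeight (x l) (y l) b),
    ← Finset.mul_prod_erase _ _ (mem_univ k)]
  congr 1
  · rw [Finset.sum_eq_single a] <;> simp +contextual
  · refine Finset.prod_congr rfl fun l hl => Finset.sum_congr rfl fun b _ => ?_
    rw [if_neg]
    exact fun h => Finset.ne_of_mem_erase hl h.1

theorem prod_erase_sum_letterWeight (x y : Fin D → Fin N) :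
    ∃ R : Prop → ℝ[X][X], ∀ k : Fin D,
      ∏ l ∈ univ.erase k, ∑ b, letterWeight (x l) (y l) b = R (x k = y k) := by
  classical
  -- The factor at `l` depends only on whether `x l = y l`. Erasing `k` lowers by one the size of
  -- the class containing `k`, which is nonempty, so the truncated subtraction is exact.
  refine ⟨fun p =>
    ((N : ℝ[X][X]) * (C X * X) + (1 - C X * X)) ^ (#{l | x l = y l} - if p then 1 else 0) *
    ((N : ℝ[X][X]) * (C X * X) + (X - C X * X) + (C X - C X * X)) ^ (#{l | x l ≠ y l} - if p then 0 else 1), fun k => ?_⟩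
  simp only [sum_letterWeight]
  rw [Finset.prod_ite, Finset.prod_const, Finset.prod_const, Finset.filter_erase,
    Finset.filter_erase, Finset.card_erase_eq_ite, Finset.card_erase_eq_ite]
  by_cases h : x k = y k <;> simp [h]

/-- The count is a coefficient of the generating function: the outer variable records distance from
`y`, the inner one distance from `x`. -/
theorem exists_card_sphere_inter_eq (x y : Fin D → Fin N) (i j : ℕ) :
    ∃ ν : Prop → Prop → Prop → ℝ, ∀ k a,
      (#{z ∈ sphere (hammingGraph D N) i x ∩ sphere (hammingGraph D N) j y | z k = a} : ℝ) =
        ν (x k = y k) (x k = a) (y k = a) := by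
  classical
  obtain ⟨R, hR⟩ := prod_erase_sum_letterWeight x y
  refine ⟨fun p q r => (((C X ^ (if q then 0 else 1) * X ^ (if r then 0 else 1) * R p).coeff
    j).coeff i), fun k a => ?_⟩
  have h := sum_prod_letterWeight x y k a
  rw [hR, letterWeight] at h
  simp only [prod_letterWeight] at h
  have h' := congrArg (fun P : ℝ[X][X] => (P.coeff j).coeff i) h
  refine Eq.trans ?_ (h'.trans (by congr))
  simp only [finsetSum_coeff, ← map_pow, coeff_C_mul, coeff_X_pow, mul_ite, mul_one, mul_zero]
  rw [Finset.card_filter, Nat.cast_sum]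
  have hs : sphere (hammingGraph D N) i x ∩ sphere (hammingGraph D N) j y =
      ({z | hammingDist x z = i ∧ hammingDist y z = j} : Finset (Fin D → Fin N)) := by
    ext z
    simp [sphere, hammingGraph_dist]
  rw [hs, Finset.sum_filter, Finset.sum_filter]
  refine Finset.sum_congr rfl fun z _ => ?_
  by_cases h1 : hammingDist x z = i <;> by_cases h2 : hammingDist y z = j <;>
    by_cases h3 : z k = a <;> simp [h1, h2, h3, Ne.symm, coeff_X_pow]

end IntersectionCounts

/-! ### The Norton product and the balanced condition. -/

section Norton

variable {D N : ℕ}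

/-- For `j ≠ k` the product is a `θ_2`-eigenvector, which `E` kills; for `j = k` it is a combination
of coordinate vectors and a constant, and `E` kills the constant. -/
theorem hammingIdempotent_entrywise_coordVec [NeZero N] (j k : Fin D) (a b : Fin N) :
    hammingIdempotent D N 1 (entrywise (coordVec j a) (coordVec k b)) =
      if j = k then (if a = b then coordVec j a else 0) -
        (N : ℝ)⁻¹ • (coordVec j a + coordVec j b) else 0 := by
  have hone : hammingIdempotent D N 1 (character ∅ (fun _ => a)) = 0 := by
    simp [hammingIdempotent_character]
  split_ifs with h h'
  · subst h h'
    have : entrywise (coordVec j a) (coordVec j a) =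
        coordVec j a - (N : ℝ)⁻¹ • (coordVec j a + coordVec j a) +
          ((N : ℝ)⁻¹ - (N : ℝ)⁻¹ ^ 2) • character ∅ (fun _ => a) := by
      ext w
      simp only [entrywise, coordVec, character, PiLp.add_apply, PiLp.sub_apply, PiLp.smul_apply,
        smul_eq_mul, prod_empty]
      split_ifs <;> ring
    rw [this]
    simp only [map_add, map_sub, map_smul, hone, hammingIdempotent_coordVec, smul_zero, add_zero]
  · subst h
    have : entrywise (coordVec j a) (coordVec j b) =
        0 - (N : ℝ)⁻¹ • (coordVec j a + coordVec j b) -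
          ((N : ℝ)⁻¹ ^ 2) • character ∅ (fun _ => a) := by
      ext w
      simp only [entrywise, coordVec, character, PiLp.add_apply, PiLp.sub_apply, PiLp.smul_apply,
        smul_eq_mul, prod_empty, PiLp.zero_apply]
      split_ifs with h1 h2
      · exact absurd (h1.symm.trans h2) h'
      all_goals ring
    rw [this]
    simp only [map_add, map_sub, map_smul, hone, hammingIdempotent_coordVec, smul_zero, sub_zero,
      map_zero]
  · have : entrywise (coordVec j a) (coordVec k b) =
        character {j, k} (Function.update (fun _ => b) j a) := by
      ext w
      simp [entrywise, coordVec, character, Finset.prod_pair h, Function.update_of_ne (Ne.symm h)]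
    rw [this, hammingIdempotent_character, Finset.card_pair h]
    simp

theorem entrywise_smul_sum {X ι : Type*} [Fintype X] [Fintype ι] (c : ℝ)
    (u v : ι → EuclideanSpace ℝ X) :
    entrywise (c • ∑ j, u j) (c • ∑ k, v k) = (c ^ 2) • ∑ j, ∑ k, entrywise (u j) (v k) := by
  ext w
  simp only [entrywise, PiLp.smul_apply, WithLp.ofLp_sum, Finset.sum_apply, smul_eq_mul]
  rw [← Finset.sum_mul_sum]
  ring

theorem nortonProduct_hammingIdempotent_hat [NeZero N] (x y : Fin D → Fin N) :
    nortonProduct (hammingIdempotent D N 1) (hammingIdempotent D N 1 (hat x))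
        (hammingIdempotent D N 1 (hat y)) =
      (((N : ℝ)⁻¹ ^ (D - 1)) ^ 2) • (∑ j with x j = y j, coordVec j (x j) -
        (N : ℝ)⁻¹ • (∑ j, coordVec j (x j) + ∑ j, coordVec j (y j))) := by
  rw [nortonProduct, hammingIdempotent_hat, hammingIdempotent_hat, entrywise_smul_sum, map_smul]
  congr 1
  simp only [map_sum, hammingIdempotent_entrywise_coordVec, Finset.sum_ite_eq, mem_univ, if_true]
  rw [Finset.sum_sub_distrib, Finset.sum_filter, ← Finset.smul_sum, Finset.sum_add_distrib]

theorem sum_smul_coordVec_pattern [NeZero N] (ν : Prop → Prop → Prop → ℝ) (j : Fin D)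
    (p q : Fin N) :
    ∑ a, ν (p = q) (p = a) (q = a) • coordVec j a =
      if p = q then (ν True True True - ν True False False) • coordVec j p
      else (ν False True False - ν False False False) • coordVec j p +
        (ν False False True - ν False False False) • coordVec j q := by
  -- By `sum_coordVec`, a constant may be subtracted from all coefficients; this one removes every
  -- letter other than `p` and `q`.
  have hsum : ∑ a, ν (p = q) (p = a) (q = a) • coordVec j a =
      ∑ a, (ν (p = q) (p = a) (q = a) - ν (p = q) False False) • coordVec j a := by
    simp only [sub_smul, Finset.sum_sub_distrib, ← Finset.smul_sum, sum_coordVec, smul_zero,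
      sub_zero]
  rw [hsum]
  split_ifs with h
  · subst h
    rw [Finset.sum_eq_single p]
    · simp
    · intro a _ ha
      simp [Ne.symm ha]
    · simp
  · rw [← Finset.sum_subset (subset_univ {p, q}), Finset.sum_pair h]
    · simp [h, Ne.symm h]
    · intro a _ ha
      simp only [mem_insert, mem_singleton, not_or] at ha
      simp [h, Ne.symm ha.1, Ne.symm ha.2]

theorem isNortonBalanced_hamming [NeZero N] :
    IsNortonBalanced (hammingGraph D N) (hammingIdempotent D N 1) := by
  intro x y i j _ _
  set W := Submodule.span ℝ ({hammingIdempotent D N 1 (hat x), hammingIdempotent D N 1 (hat y),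
    nortonProduct (hammingIdempotent D N 1) (hammingIdempotent D N 1 (hat x))
      (hammingIdempotent D N 1 (hat y))} : Set (EuclideanSpace ℝ (Fin D → Fin N))) with hW
  have hc : ((N : ℝ)⁻¹ ^ (D - 1)) ≠ 0 := pow_ne_zero _ (inv_ne_zero (NeZero.ne _))
  have hx : ∑ k, coordVec k (x k) ∈ W := by
    have : hammingIdempotent D N 1 (hat x) ∈ W := Submodule.subset_span (by simp)
    rw [hammingIdempotent_hat] at this
    exact (Submodule.smul_mem_iff _ hc).1 this
  have hy : ∑ k, coordVec k (y k) ∈ W := by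
    have : hammingIdempotent D N 1 (hat y) ∈ W := Submodule.subset_span (by simp)
    rw [hammingIdempotent_hat] at this
    exact (Submodule.smul_mem_iff _ hc).1 this
  -- The only use of the third generator: modulo `hx` and `hy`, the Norton product is a nonzero
  -- multiple of this sum.
  have hxy : ∑ k with x k = y k, coordVec k (x k) ∈ W := by
    have : nortonProduct (hammingIdempotent D N 1) (hammingIdempotent D N 1 (hat x))
      (hammingIdempotent D N 1 (hat y)) ∈ W := Submodule.subset_span (by simp)
    rw [nortonProduct_hammingIdempotent_hat, Submodule.smul_mem_iff _ (pow_ne_zero 2 hc)] at this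
    exact (Submodule.sub_mem_iff_left _ (W.smul_mem _ (W.add_mem hx hy))).1 this
  have hx' : ∑ k with ¬ x k = y k, coordVec k (x k) ∈ W := by
    rw [← Finset.sum_filter_add_sum_filter_not univ (fun k => x k = y k)] at hx
    exact (Submodule.add_mem_iff_right _ hxy).1 hx
  have hy' : ∑ k with ¬ x k = y k, coordVec k (y k) ∈ W := by
    rw [← Finset.sum_filter_add_sum_filter_not univ (fun k => x k = y k)] at hy
    refine (Submodule.add_mem_iff_right _ ?_).1 hy
    rwa [Finset.sum_congr rfl (g := fun k => coordVec k (x k))]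
    intro k hk
    rw [(mem_filter.1 hk).2]
  obtain ⟨ν, hν⟩ := exists_card_sphere_inter_eq x y i j
  simp only [hammingIdempotent_hat]
  rw [← Finset.smul_sum, Finset.sum_comm]
  refine W.smul_mem _ ?_
  have h : ∀ k, ∑ z ∈ sphere (hammingGraph D N) i x ∩ sphere (hammingGraph D N) j y,
      coordVec k (z k) = ∑ a, ν (x k = y k) (x k = a) (y k = a) • coordVec k a := by
    intro k
    -- Grouping the `z` by their letter at `k` turns the sum into the counts `ν`.
    rw [← Finset.sum_fiberwise _ (fun z => z k)]
    refine Finset.sum_congr rfl fun a _ => ?_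
    rw [Finset.sum_congr rfl (g := fun _ => coordVec k a), Finset.sum_const, ← hν,
      Nat.cast_smul_eq_nsmul]
    intro z hz
    rw [(mem_filter.1 hz).2]
  simp only [h, sum_smul_coordVec_pattern]
  rw [Finset.sum_ite, Finset.sum_add_distrib, ← Finset.smul_sum, ← Finset.smul_sum,
    ← Finset.smul_sum]
  exact W.add_mem (W.smul_mem _ hxy) (W.add_mem (W.smul_mem _ hx') (W.smul_mem _ hy'))

end Norton

end NortonBalanced

theorem mainTheorem8 (D N : ℕ) (hD : 3 ≤ D) (hN : 2 ≤ N) :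
    (∀ x y : Fin D → Fin N, ∀ i : ℕ, (NortonBalanced.hammingGraph D N).dist x y = i →
      2 ≤ i → i ≤ D →
      NortonBalanced.hammingIdempotent D N 1
          (NortonBalanced.vecMinus (NortonBalanced.hammingGraph D N) x y) =
        ((i : ℝ) - 1) • NortonBalanced.hammingIdempotent D N 1 (NortonBalanced.hat x) +
          NortonBalanced.hammingIdempotent D N 1 (NortonBalanced.hat y)) ∧
    (N = 2 → ∀ x y : Fin D → Fin N, ∀ i : ℕ, (NortonBalanced.hammingGraph D N).dist x y = i →
      1 ≤ i → i + 1 ≤ D →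
      NortonBalanced.hammingIdempotent D N 1
          (NortonBalanced.vecPlus (NortonBalanced.hammingGraph D N) x y) =
        ((D : ℝ) - (i : ℝ) - 1) • NortonBalanced.hammingIdempotent D N 1 (NortonBalanced.hat x) -
          NortonBalanced.hammingIdempotent D N 1 (NortonBalanced.hat y)) ∧
    NortonBalanced.IsNortonBalanced (NortonBalanced.hammingGraph D N)
      (NortonBalanced.hammingIdempotent D N 1) := by
  have : NeZero N := ⟨by omega⟩
  refine ⟨?_, ?_, NortonBalanced.isNortonBalanced_hamming⟩
  · rintro x y i rfl _ _
    rw [NortonBalanced.hammingGraph_dist]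
    exact NortonBalanced.hammingIdempotent_vecMinus x y
  · rintro rfl x y i rfl _ _
    rw [NortonBalanced.hammingGraph_dist]
    exact NortonBalanced.hammingIdempotent_vecPlus_two x y
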